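/- For $a\in\mathbb{C}$ with $\Re(a)>0$, let $\zeta(\sigma,a)$ be the Hurwitz zeta function, i.e. the analytic continuation to $\sigma\in\mathbb{C}\setminus\{1\}$ of $\sum_{k\ge 0}(k+a)^{-\sigma}$ ($\Re\sigma>1$), let $\zeta^{(r,0)}(\sigma,a)$ denote its $r$-th derivative with respect to $\sigma$, and let the generalized Stieltjes constants $\gamma_\ell(a)$ be defined by the Laurent expansion $$\zeta(\sigma,a)=\frac1{\sigma-1}+\sum_{\ell\ge 0}\frac{(-1)^\ell}{\ell!}\gamma_\ell(a)(\sigma-1)^\ell$$ at $\sigma=1$. Let $(x)_j=x(x+1)\cdots(x+j-1)$, and let $s(n,k)$ be the (signed) Stirling numbers of the first kind, defined by $(x)_n=\sum_{k=0}^n(-1)^{n-k}s(n,k)x^k$. Powers and $\ln$ are principal. Suppose that $\Re(a)>0$ and $|a|\ge 1$. Then for all integers $\ell,m,n\ge 0$ with $m+n\ge 1$, $$\begin{aligned}(-1)^\ell\gamma_\ell(a)={}&\sum_{j=2}^{\max(m,n)}\frac{(-m)_j-(-1)^j(-n)_j}{(-n-m)_j}\,\frac{(-1)^j}{j!}\sum_{k=0}^{\ell}s(j,k+1)\frac{\ell!}{(\ell-k)!}(-1)^k\zeta^{(\ell-k,0)}(j,a)\\&+\sum_{k=0}^{\ell}\frac{\ell!}{(\ell-k)!}\ln^{\ell-k}a\sum_{j=1}^{m}\frac{(-m)_j}{(-n-m)_j}\,\frac{(-1)^{j+\ell+1}a^{-j}}{j!}\,s(j,k+1)\\&+\frac{\ln^{\ell+1}a}{\ell+1}(-1)^{\ell+1}+R_{\ell,m,n,a},\end{aligned}$$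 where $$R_{\ell,m,n,a}=\frac{(-1)^{m+1}}{(m+n)!}\sum_{k=0}^{\ell}s(m+n+1,k+1)\frac{\ell!}{(\ell-k)!}(-1)^k\int_0^1x^m(1-x)^n\,\zeta^{(\ell-k,0)}(m+n+1,a+x)\,dx,$$ all these integrals being (absolutely) convergent. -/

import Mathlib

open scoped Nat

noncomputable section

/-- The Hurwitz series `∑_{k ≥ 0} 1 / (k + a)^σ` (principal powers), convergent for `Re σ > 1`
when `Re a > 0`. -/
def hurwitzSeries (σ a : ℂ) : ℂ := ∑' k : ℕ, 1 / ((k : ℂ) + a) ^ σ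

/-- `Z` is an analytic continuation of `σ ↦ ∑_{k ≥ 0} 1 / (k + a)^σ` to the half-plane `Re σ > c`
with the point `1` removed. As this domain is connected, `Z` is uniquely determined there. -/
structure IsHurwitzContinuation (a : ℂ) (c : ℝ) (Z : ℂ → ℂ) : Prop where
  differentiableOn : DifferentiableOn ℂ Z {s : ℂ | c < s.re ∧ s ≠ 1}
  eq_series : ∀ s : ℂ, 1 < s.re → Z s = hurwitzSeries s a

open Classical in
/-- The Hurwitz zeta function `ζ(σ, a)`, for complex `a` with `Re a > 0` and `σ ≠ 1`: the value at
`σ` of the analytic continuation of the Hurwitz series to a half-plane containing `σ`, with the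
pole `1` removed. (All these continuations agree, and they exist for every half-plane.)
The value at the pole `σ = 1` is set to `0`. -/
def hurwitzZetaC (σ a : ℂ) : ℂ :=
  if h : σ ≠ 1 ∧ ∃ w : ℂ, ∃ c : ℝ, ∃ Z : ℂ → ℂ,
      c < σ.re ∧ IsHurwitzContinuation a c Z ∧ w = Z σ
  then Classical.choose h.2 else 0

/-- `ζ^{(r,0)}(σ, a)`: the `r`-th derivative of the Hurwitz zeta function in its first variable. -/
def hurwitzZetaDeriv (r : ℕ) (σ a : ℂ) : ℂ := iteratedDeriv r (fun s => hurwitzZetaC s a) σ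

/-- `γ` is the sequence of coefficients in the Laurent expansion of `ζ(·, a)` at its pole `1`:
`ζ(σ, a) = 1 / (σ - 1) + ∑_{ℓ ≥ 0} (-1)^ℓ / ℓ! * γ_ℓ * (σ - 1)^ℓ` for all `σ ≠ 1` near `1`. -/
def IsStieltjesSeq (a : ℂ) (γ : ℕ → ℂ) : Prop :=
  ∃ r : ℝ, 0 < r ∧ ∀ σ : ℂ, σ ≠ 1 → ‖σ - 1‖ < r →
    HasSum (fun ℓ : ℕ => (-1) ^ ℓ / (ℓ ! : ℂ) * γ ℓ * (σ - 1) ^ ℓ)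
      (hurwitzZetaC σ a - 1 / (σ - 1))

open Classical in
/-- The generalized Stieltjes constants `γ_ℓ(a)`. -/
def stieltjesConst (ℓ : ℕ) (a : ℂ) : ℂ :=
  if h : ∃ γ : ℕ → ℂ, IsStieltjesSeq a γ then Classical.choose h ℓ else 0

/-- The Pochhammer symbol `(x)_j = x (x + 1) ⋯ (x + j - 1)`. -/
def poch (x : ℂ) (j : ℕ) : ℂ := (ascPochhammer ℂ j).eval x

/-- The signed Stirling numbers of the first kind, given by
`(x)_n = ∑_k (-1)^(n - k) s(n, k) x^k`. -/
def stirlingS (n k : ℕ) : ℤ := (-1) ^ (n + k) * (ascPochhammer ℤ n).coeff k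

/-- The integrand `x^m (1 - x)^n ζ^{(r,0)}(m + n + 1, a + x)`. -/
def remainderIntegrand (r m n : ℕ) (a : ℂ) (x : ℝ) : ℂ :=
  (x : ℂ) ^ m * (1 - (x : ℂ)) ^ n * hurwitzZetaDeriv r ((m : ℂ) + n + 1) (a + x)

/-- The remainder `R_{ℓ,m,n,a}`. -/
def stieltjesRemainder (ℓ m n : ℕ) (a : ℂ) : ℂ :=
  (-1) ^ (m + 1) / ((m + n)! : ℂ) *
    ∑ k ∈ Finset.range (ℓ + 1),
      (stirlingS (m + n + 1) (k + 1) : ℂ) * ((ℓ ! : ℂ) / ((ℓ - k)! : ℂ)) * (-1) ^ k *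
        ∫ x in (0 : ℝ)..1, remainderIntegrand (ℓ - k) m n a x

end

/-!
The formula is the Taylor expansion at `σ = 1` of an identity for `ζ(σ, a)`. Write `N = m + n`,
`A_j = (-m)_j / (-N)_j` and `B_j = (-n)_j / (-N)_j`. Repeated integration by parts against
`x ^ m (1 - x) ^ n` gives Obreschkoff's two-point Taylor formula (`obreschkoff_formula`). Applied to
`x ↦ (k + a + x) ^ (1 - σ) / (1 - σ)` and summed over `k ≥ 0`, where the terms of order `0`
telescope, it becomes for `Re σ > 1`
(`hurwitzSeries_eq_add_obreschkoffRegularPart`)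

`ζ(σ, a) = a ^ (1 - σ) / (σ - 1) + ∑_{1 ≤ j ≤ m} A_j (σ)_{j-1} a ^ (1 - σ - j) / j!`
`  - ∑_{2 ≤ j ≤ max m n} (A_j - (-1) ^ j B_j) (σ)_{j-1} ζ(σ + j - 1, a) / j!`
`  - (-1) ^ n (σ)_N / N! * ∫_0^1 x ^ m (1 - x) ^ n ζ(σ + N, a + x) dx`.

Since `N ≥ 1`, the right side involves only the convergent series when `Re σ > 0`. So it is the
analytic continuation of `ζ(·, a)` to that half-plane (`isHurwitzContinuation_obreschkoff`), and
its pole part is exactly `1 / (σ - 1)`. By uniqueness of Laurent coefficients, `(-1) ^ ℓ γ_ℓ(a)` is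
the `ℓ`-th derivative at `1` of the right side minus `1 / (σ - 1)`
(`neg_one_pow_mul_stieltjesConst`).

This derivative is computed with Leibniz' rule, the derivatives of `(σ)_{j-1}` at `1` being Stirling
numbers because `(s)_j = s (s + 1)_{j-1}` (`iteratedDeriv_poch_mul`); the derivatives of
`(a ^ (1 - σ) - 1) / (σ - 1)` are those of a difference quotient (`iteratedDeriv_dslope_self`). For
the remainder, derivatives in `σ` pass under the integral because `ζ(s, b)` is jointly continuous
and holomorphic in `s` (`iteratedDeriv_integral_of_continuousOn_uncurry`).
-/

section

open MeasureTheory Filter Topology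

/-! ### Families of holomorphic functions and their integrals -/

/-- For a jointly continuous family of holomorphic functions, `F x → F x₀` locally uniformly as
`x → x₀`; by Weierstrass' theorem the derivatives then also converge locally uniformly, which makes
them jointly continuous. -/
theorem continuousOn_deriv_of_continuousOn_uncurry {X : Type*} [TopologicalSpace X]
    {F : X → ℂ → ℂ} {I : Set X} {U : Set ℂ} (hU : IsOpen U)
    (hF : ContinuousOn (fun p : X × ℂ => F p.1 p.2) (I ×ˢ U))
    (hd : ∀ x ∈ I, DifferentiableOn ℂ (F x) U) :
    ContinuousOn (fun p : X × ℂ => deriv (F p.1) p.2) (I ×ˢ U) := by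
  rintro ⟨x₀, s₀⟩ ⟨hx₀, hs₀⟩
  simp only at hx₀ hs₀
  have hlu : TendstoLocallyUniformlyOn F (F x₀) (𝓝[I] x₀) U := by
    rw [Metric.tendstoLocallyUniformlyOn_iff]
    intro ε hε s hs
    have h1 := Metric.tendsto_nhds.1 (hF (x₀, s) ⟨hx₀, hs⟩) (ε / 2) (half_pos hε)
    rw [nhdsWithin_prod_eq] at h1
    obtain ⟨pa, ha, pb, hb, hab⟩ := Filter.eventually_prod_iff.1 h1
    refine ⟨{t | pb t}, hb, ?_⟩
    filter_upwards [ha] with x hx t ht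
    have h2 := hab hx ht
    have h3 := hab (ha.self_of_nhdsWithin hx₀) ht
    simp only at h2 h3
    calc dist (F x₀ t) (F x t) ≤ dist (F x₀ t) (F x₀ s) + dist (F x t) (F x₀ s) :=
          dist_triangle_right _ _ _
      _ < ε := by linarith
  have hlu' : TendstoLocallyUniformlyOn (deriv ∘ F) (deriv (F x₀)) (𝓝[I] x₀) U :=
    hlu.deriv (eventually_mem_nhdsWithin.mono hd) hU
  have hc : ContinuousAt (deriv (F x₀)) s₀ :=
    (((hd x₀ hx₀).deriv hU).continuousOn).continuousAt (hU.mem_nhds hs₀)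
  rw [ContinuousWithinAt, Metric.tendsto_nhds]
  intro ε hε
  rw [Metric.tendstoLocallyUniformlyOn_iff] at hlu'
  obtain ⟨t, ht, h⟩ := hlu' (ε / 2) (half_pos hε) s₀ hs₀
  have h2 := Metric.tendsto_nhds.1 hc (ε / 2) (half_pos hε)
  rw [nhdsWithin_prod_eq]
  refine Filter.eventually_prod_iff.2 ⟨_, h,
    fun y => y ∈ t ∧ dist (deriv (F x₀) y) (deriv (F x₀) s₀) < ε / 2,
    (show ∀ᶠ y in 𝓝[U] s₀, y ∈ t from ht).and (h2.filter_mono nhdsWithin_le_nhds), ?_⟩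
  rintro x hx y ⟨hy, hy'⟩
  have := hx y hy
  simp only [Function.comp] at this ⊢
  calc dist (deriv (F x) y) (deriv (F x₀) s₀)
      ≤ dist (deriv (F x₀) y) (deriv (F x) y) + dist (deriv (F x₀) y) (deriv (F x₀) s₀) :=
        dist_triangle_left _ _ _
    _ < ε := by linarith

/-- Joint continuity of all derivatives in the holomorphic variable; in particular they are
integrable in the other one on compact sets. -/
theorem continuousOn_iteratedDeriv_of_continuousOn_uncurry {X : Type*} [TopologicalSpace X]
    {I : Set X} {U : Set ℂ} (hU : IsOpen U) (r : ℕ) {F : X → ℂ → ℂ}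
    (hF : ContinuousOn (fun p : X × ℂ => F p.1 p.2) (I ×ˢ U))
    (hd : ∀ x ∈ I, DifferentiableOn ℂ (F x) U) :
    ContinuousOn (fun p : X × ℂ => iteratedDeriv r (F p.1) p.2) (I ×ˢ U) := by
  induction r generalizing F with
  | zero => simpa using hF
  | succ r ih =>
    simp only [iteratedDeriv_succ']
    exact ih (F := fun x => deriv (F x)) (continuousOn_deriv_of_continuousOn_uncurry hU hF hd)
      fun x hx => (hd x hx).deriv hU

theorem continuousOn_slice {I : Set ℝ} {U : Set ℂ} {F : ℝ → ℂ → ℂ}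
    (hF : ContinuousOn (fun p : ℝ × ℂ => F p.1 p.2) (I ×ˢ U)) {s : ℂ} (hs : s ∈ U) :
    ContinuousOn (fun x => F x s) I :=
  hF.comp (f := fun x => (x, s)) (by fun_prop) fun x hx => ⟨hx, hs⟩

theorem hasDerivAt_integral_of_continuousOn_uncurry {U : Set ℂ} (hU : IsOpen U) {F : ℝ → ℂ → ℂ}
    (hF : ContinuousOn (fun p : ℝ × ℂ => F p.1 p.2) (Set.Icc 0 1 ×ˢ U))
    (hd : ∀ x ∈ Set.Icc (0 : ℝ) 1, DifferentiableOn ℂ (F x) U) {s : ℂ} (hs : s ∈ U) :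
    HasDerivAt (fun s => ∫ x in (0 : ℝ)..1, F x s) (∫ x in (0 : ℝ)..1, deriv (F x) s) s := by
  have hF' := continuousOn_deriv_of_continuousOn_uncurry hU hF hd
  obtain ⟨ε, hε, hεU⟩ := Metric.nhds_basis_closedBall.mem_iff.1 (hU.mem_nhds hs)
  obtain ⟨C, hC⟩ := ((isCompact_Icc (a := (0 : ℝ)) (b := 1)).prod
    (isCompact_closedBall s ε)).exists_bound_of_continuousOn
      (hF'.mono (Set.prod_mono_right hεU))
  have hsub : Set.uIoc (0 : ℝ) 1 ⊆ Set.Icc 0 1 := by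
    rw [Set.uIoc_of_le zero_le_one]; exact Set.Ioc_subset_Icc_self
  refine (intervalIntegral.hasDerivAt_integral_of_dominated_loc_of_deriv_le
    (F := fun s x => F x s) (F' := fun s x => deriv (F x) s) (bound := fun _ => C)
    (Metric.closedBall_mem_nhds s hε) ?_ ?_ ?_ ?_ ?_ ?_).2
  · filter_upwards [hU.mem_nhds hs] with t ht
    exact ((continuousOn_slice hF ht).mono hsub).aestronglyMeasurable measurableSet_uIoc
  · exact ContinuousOn.intervalIntegrable_of_Icc zero_le_one (continuousOn_slice hF hs)
  · exact ((continuousOn_slice (F := fun x => deriv (F x)) hF' hs).mono hsub).aestronglyMeasurable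
      measurableSet_uIoc
  · exact Eventually.of_forall fun x hx t ht => hC (x, t) ⟨hsub hx, ht⟩
  · simp
  · exact Eventually.of_forall fun x hx t ht =>
      ((hd x (hsub hx)).differentiableAt (hU.mem_nhds (hεU ht))).hasDerivAt

/-- Derivatives of every order in the parameter pass under the integral sign. -/
theorem iteratedDeriv_integral_of_continuousOn_uncurry {U : Set ℂ} (hU : IsOpen U) (r : ℕ)
    {F : ℝ → ℂ → ℂ}
    (hF : ContinuousOn (fun p : ℝ × ℂ => F p.1 p.2) (Set.Icc 0 1 ×ˢ U))
    (hd : ∀ x ∈ Set.Icc (0 : ℝ) 1, DifferentiableOn ℂ (F x) U) {s : ℂ} (hs : s ∈ U) :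
    iteratedDeriv r (fun s => ∫ x in (0 : ℝ)..1, F x s) s =
      ∫ x in (0 : ℝ)..1, iteratedDeriv r (F x) s := by
  induction r generalizing F with
  | zero => simp
  | succ r ih =>
    simp only [iteratedDeriv_succ']
    rw [← ih (F := fun x => deriv (F x)) (continuousOn_deriv_of_continuousOn_uncurry hU hF hd)
      fun x hx => (hd x hx).deriv hU]
    refine Filter.EventuallyEq.iteratedDeriv_eq r ?_
    filter_upwards [hU.mem_nhds hs] with t ht
    exact (hasDerivAt_integral_of_continuousOn_uncurry hU hF hd ht).deriv

/-! ### The Hurwitz series -/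

theorem natCast_add_ne_zero_of_re_pos {b : ℂ} (hb : 0 < b.re) (k : ℕ) : (k : ℂ) + b ≠ 0 := by
  intro h
  have := congrArg Complex.re h
  simp at this
  have h2 : (0 : ℝ) ≤ k := k.cast_nonneg
  linarith

theorem natCast_add_mem_slitPlane {b : ℂ} (hb : 0 < b.re) (k : ℕ) :
    (k : ℂ) + b ∈ Complex.slitPlane := by
  left
  simp
  positivity

/-- Majorant of the terms `k ≥ 1` of the Hurwitz series, uniform in `Re b > 0` and in `s` on a
half-strip. The term `k = 0` is not bounded there, as `b` may be close to `0`, and is split off. -/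
theorem norm_one_div_cpow_le {σ M : ℝ} (hσ : 0 ≤ σ) {s b : ℂ} (hs : σ ≤ s.re) (hM : |s.im| ≤ M)
    (hb : 0 < b.re) (k : ℕ) :
    ‖1 / (((k + 1 : ℕ) : ℂ) + b) ^ s‖ ≤ Real.exp (Real.pi * M) * (1 / ((k + 1 : ℕ) : ℝ) ^ σ) := by
  set z : ℂ := ((k + 1 : ℕ) : ℂ) + b with hz
  have hz0 : z ≠ 0 := natCast_add_ne_zero_of_re_pos hb _
  have hk : (1 : ℝ) ≤ ((k + 1 : ℕ) : ℝ) := by exact_mod_cast Nat.succ_le_succ k.zero_le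
  have hnz : ((k + 1 : ℕ) : ℝ) ≤ ‖z‖ := by
    refine le_trans ?_ (Complex.re_le_norm z)
    simp [hz]; exact hb.le
  rw [norm_div, norm_one, Complex.norm_cpow_of_ne_zero hz0, one_div_div, ← mul_one_div]
  refine mul_le_mul (Real.exp_le_exp.2 ?_) ?_ (by positivity) (by positivity)
  · calc z.arg * s.im ≤ |z.arg| * |s.im| := by rw [← abs_mul]; exact le_abs_self _
      _ ≤ Real.pi * M := mul_le_mul (Complex.abs_arg_le_pi z) hM (abs_nonneg _) Real.pi_pos.le
  · refine one_div_le_one_div_of_le (by positivity) ?_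
    calc ((k + 1 : ℕ) : ℝ) ^ σ ≤ ‖z‖ ^ σ := Real.rpow_le_rpow (by positivity) hnz hσ
      _ ≤ ‖z‖ ^ s.re := Real.rpow_le_rpow_of_exponent_le (hk.trans hnz) hs

theorem summable_const_mul_one_div_succ_rpow {σ : ℝ} (hσ : 1 < σ) (C : ℝ) :
    Summable fun k : ℕ => C * (1 / ((k + 1 : ℕ) : ℝ) ^ σ) :=
  ((summable_nat_add_iff 1).2 (Real.summable_one_div_nat_rpow.2 hσ)).mul_left C

theorem summable_hurwitzSeries {s b : ℂ} (hs : 1 < s.re) (hb : 0 < b.re) :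
    Summable fun k : ℕ => 1 / ((k : ℂ) + b) ^ s :=
  (summable_nat_add_iff 1).1 <| Summable.of_norm_bounded
    (summable_const_mul_one_div_succ_rpow hs _) fun k =>
      norm_one_div_cpow_le (by linarith) le_rfl le_rfl hb k

theorem hurwitzSeries_eq_add_succ {s b : ℂ} (hs : 1 < s.re) (hb : 0 < b.re) :
    hurwitzSeries s b = 1 / b ^ s + ∑' k : ℕ, 1 / (((k + 1 : ℕ) : ℂ) + b) ^ s := by
  rw [hurwitzSeries, (summable_hurwitzSeries hs hb).tsum_eq_zero_add]
  simp

theorem hurwitzSeries_add_one {s b : ℂ} (hs : 1 < s.re) (hb : 0 < b.re) :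
    hurwitzSeries s (b + 1) = hurwitzSeries s b - 1 / b ^ s := by
  rw [hurwitzSeries_eq_add_succ hs hb, add_sub_cancel_left, hurwitzSeries]
  simp only [Nat.cast_add, Nat.cast_one, add_assoc, add_comm b]

/-- The half-strip `Re s > σ`, `|Im s| < M`, on which the tail of the Hurwitz series converges
uniformly once `σ > 1`. -/
def hurwitzTailRegion (σ M : ℝ) : Set ℂ := {s | σ < s.re ∧ |s.im| < M}

theorem isOpen_hurwitzTailRegion (σ M : ℝ) : IsOpen (hurwitzTailRegion σ M) :=
  (isOpen_lt continuous_const Complex.continuous_re).inter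
    (isOpen_lt (continuous_abs.comp Complex.continuous_im) continuous_const)

theorem continuousOn_one_div_cpow (k : ℕ) :
    ContinuousOn (fun p : ℂ × ℂ => 1 / ((k : ℂ) + p.1) ^ p.2) ({b | 0 < b.re} ×ˢ Set.univ) := by
  rintro ⟨b, s⟩ ⟨hb, -⟩
  simp only [one_div, ← Complex.cpow_neg]
  have : ContinuousAt (fun p : ℂ × ℂ => ((k : ℂ) + p.1) ^ (-p.2)) (b, s) :=
    ContinuousAt.cpow (by fun_prop) (by fun_prop) (natCast_add_mem_slitPlane hb k)
  exact this.continuousWithinAt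

theorem isOpen_re_lt_right (c : ℝ) : IsOpen {s : ℂ | c < s.re} :=
  isOpen_lt continuous_const Complex.continuous_re

theorem continuousOn_hurwitzSeries_uncurry :
    ContinuousOn (fun p : ℂ × ℂ => hurwitzSeries p.2 p.1) ({b | 0 < b.re} ×ˢ {s | 1 < s.re}) := by
  rintro ⟨b₀, s₀⟩ ⟨hb₀, hs₀⟩
  replace hb₀ : 0 < b₀.re := hb₀
  replace hs₀ : 1 < s₀.re := hs₀
  obtain ⟨σ, h1σ, hσ⟩ := exists_between hs₀
  have hV : hurwitzTailRegion σ (|s₀.im| + 1) ∈ 𝓝 s₀ :=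
    (isOpen_hurwitzTailRegion _ _).mem_nhds ⟨hσ, by linarith⟩
  have hc : ContinuousOn (fun p : ℂ × ℂ => 1 / p.1 ^ p.2 +
      ∑' k : ℕ, 1 / (((k + 1 : ℕ) : ℂ) + p.1) ^ p.2)
      ({b | 0 < b.re} ×ˢ hurwitzTailRegion σ (|s₀.im| + 1)) := by
    refine ContinuousOn.add ?_ (continuousOn_tsum (fun k => ?_)
      (summable_const_mul_one_div_succ_rpow h1σ (Real.exp (Real.pi * (|s₀.im| + 1)))) ?_)
    · simpa using (continuousOn_one_div_cpow 0).mono (Set.prod_mono_right (Set.subset_univ _))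
    · exact (continuousOn_one_div_cpow (k + 1)).mono (Set.prod_mono_right (Set.subset_univ _))
    · rintro k ⟨b, s⟩ ⟨hb, hs⟩
      exact norm_one_div_cpow_le (by linarith) hs.1.le hs.2.le hb k
  have hmem : {b : ℂ | 0 < b.re} ×ˢ hurwitzTailRegion σ (|s₀.im| + 1) ∈ 𝓝 (b₀, s₀) :=
    prod_mem_nhds ((isOpen_re_lt_right 0).mem_nhds hb₀) hV
  refine ((hc.continuousAt hmem).congr ?_).continuousWithinAt
  filter_upwards [hmem] with p hp
  exact (hurwitzSeries_eq_add_succ (h1σ.trans hp.2.1) hp.1).symm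

theorem differentiableOn_hurwitzSeries {b : ℂ} (hb : 0 < b.re) :
    DifferentiableOn ℂ (fun s => hurwitzSeries s b) {s | 1 < s.re} := by
  have hterm : ∀ k : ℕ, Differentiable ℂ fun s : ℂ => 1 / ((k : ℂ) + b) ^ s := fun k s => by
    simp only [one_div, ← Complex.cpow_neg]
    exact (differentiableAt_id.neg).const_cpow (Or.inl (natCast_add_ne_zero_of_re_pos hb k))
  intro s₀ hs₀
  obtain ⟨σ, h1σ, hσ⟩ := exists_between (show 1 < s₀.re from hs₀)
  have hV : hurwitzTailRegion σ (|s₀.im| + 1) ∈ 𝓝 s₀ :=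
    (isOpen_hurwitzTailRegion _ _).mem_nhds ⟨hσ, by linarith⟩
  have hd : DifferentiableOn ℂ (fun s => 1 / b ^ s +
      ∑' k : ℕ, 1 / (((k + 1 : ℕ) : ℂ) + b) ^ s) (hurwitzTailRegion σ (|s₀.im| + 1)) := by
    refine DifferentiableOn.add ?_ (Complex.differentiableOn_tsum_of_summable_norm
      (summable_const_mul_one_div_succ_rpow h1σ (Real.exp (Real.pi * (|s₀.im| + 1))))
      (fun k => (hterm (k + 1)).differentiableOn) (isOpen_hurwitzTailRegion _ _) ?_)
    · simpa using (hterm 0).differentiableOn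
    · exact fun k s hs => norm_one_div_cpow_le (by linarith) hs.1.le hs.2.le hb k
  refine ((hd.differentiableAt hV).congr_of_eventuallyEq ?_).differentiableWithinAt
  filter_upwards [hV] with s hs
  exact hurwitzSeries_eq_add_succ (h1σ.trans hs.1) hb

/-! ### Obreschkoff's two-point Taylor formula -/

theorem neg_one_pow_mul_self (j : ℕ) : ((-1 : ℂ) ^ j) * (-1) ^ j = 1 := by
  rw [← mul_pow]; simp

open Polynomial in
/-- Repeated integration by parts against a polynomial of degree at most `N`, for a sequence `f` of
functions each of which is the derivative of the preceding one. -/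
theorem integral_polynomial_mul_deriv_chain (N : ℕ) (p : ℂ[X]) (hp : p.natDegree ≤ N)
    (f : ℕ → ℝ → ℂ) (hf : ∀ j, ∀ x ∈ Set.Icc (0 : ℝ) 1, HasDerivAt (f j) (f (j + 1) x) x) :
    ∫ x in (0 : ℝ)..1, p.eval (x : ℂ) * f (N + 1) x =
      ∑ j ∈ Finset.range (N + 1), (-1) ^ (N - j) *
        ((derivative^[N - j] p).eval 1 * f j 1 - (derivative^[N - j] p).eval 0 * f j 0) := by
  have hI : Set.uIcc (0 : ℝ) 1 = Set.Icc 0 1 := Set.uIcc_of_le zero_le_one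
  have hp' : ∀ q : ℂ[X], ∀ x : ℝ,
      HasDerivAt (fun x : ℝ => q.eval (x : ℂ)) (q.derivative.eval (x : ℂ)) x := fun q x =>
    (q.hasDerivAt (x : ℂ)).comp_ofReal
  have hcont : ∀ j, ContinuousOn (f j) (Set.Icc 0 1) := fun j x hx =>
    (hf j x hx).continuousAt.continuousWithinAt
  have key : ∀ (q : ℂ[X]) (j : ℕ), ∫ x in (0 : ℝ)..1, q.eval (x : ℂ) * f (j + 1) x =
      q.eval 1 * f j 1 - q.eval 0 * f j 0 -
        ∫ x in (0 : ℝ)..1, q.derivative.eval (x : ℂ) * f j x := fun q j => by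
    have := intervalIntegral.integral_mul_deriv_eq_deriv_mul (a := 0) (b := 1)
      (u := fun x : ℝ => q.eval (x : ℂ)) (u' := fun x : ℝ => q.derivative.eval (x : ℂ))
      (v := f j) (v' := f (j + 1)) (fun x _ => hp' q x) (fun x hx => hf j x (hI ▸ hx))
      (Continuous.intervalIntegrable (by fun_prop) _ _)
      (ContinuousOn.intervalIntegrable (hI ▸ hcont (j + 1)))
    simpa using this
  induction N generalizing p with
  | zero =>
    rw [key, eq_C_of_natDegree_le_zero hp]
    simp
  | succ N ih =>
    rw [key, ih p.derivative ((natDegree_derivative_le p).trans (by omega))]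
    conv_rhs => rw [Finset.sum_range_succ]
    simp only [Nat.sub_self, pow_zero, one_mul, Function.iterate_zero, id_eq]
    rw [sub_eq_neg_add, ← Finset.sum_neg_distrib]
    refine congrArg₂ (· + ·) ?_ rfl
    refine Finset.sum_congr rfl fun j hj => ?_
    have hj : j ≤ N := Nat.lt_succ_iff.1 (Finset.mem_range.1 hj)
    rw [Nat.succ_sub hj, Function.iterate_succ_apply, pow_succ]
    ring

open Polynomial in
theorem eval_iterate_derivative_eq_taylor_coeff (p : ℂ[X]) (k : ℕ) (c : ℂ) :
    (derivative^[k] p).eval c = (k ! : ℂ) * (taylor c p).coeff k := by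
  rw [taylor_coeff, ← factorial_smul_hasseDeriv]
  simp

open Polynomial in
/-- The derivatives of `X ^ m * (1 - X) ^ n` at `0`. The binomial coefficient is `0` for `j > n`. -/
theorem eval_zero_iterate_derivative_beta {m n j : ℕ} (hj : j ≤ m + n) :
    (derivative^[m + n - j] (X ^ m * (1 - X) ^ n : ℂ[X])).eval 0 =
      ((m + n - j)! : ℂ) * ((-1) ^ (n + j) * (n.choose j : ℂ)) := by
  rw [eval_iterate_derivative_eq_taylor_coeff, taylor_zero]
  congr 1
  have hsub : (1 - X : ℂ[X]) ^ n = ((1 + X) ^ n).comp (C (-1) * X) := by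
    simp [sub_eq_add_neg]
  rw [coeff_X_pow_mul', hsub, comp_C_mul_X_coeff, coeff_one_add_X_pow]
  split_ifs with h
  · have hjn : j ≤ n := by omega
    rw [show m + n - j - m = n - j by omega, Nat.choose_symm hjn, mul_comm]
    congr 1
    rw [← Nat.sub_add_cancel hjn, add_assoc, Nat.sub_add_cancel hjn, pow_add, ← two_mul, pow_mul]
    simp
  · rw [Nat.choose_eq_zero_of_lt (by omega)]
    simp

open Polynomial in
/-- The derivatives of `X ^ m * (1 - X) ^ n` at `1`. The binomial coefficient is `0` for `j > m`. -/
theorem eval_one_iterate_derivative_beta {m n j : ℕ} (hj : j ≤ m + n) :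
    (derivative^[m + n - j] (X ^ m * (1 - X) ^ n : ℂ[X])).eval 1 =
      ((m + n - j)! : ℂ) * ((-1) ^ n * (m.choose j : ℂ)) := by
  rw [eval_iterate_derivative_eq_taylor_coeff]
  congr 1
  have ht : taylor 1 (X ^ m * (1 - X) ^ n : ℂ[X]) = C ((-1) ^ n) * (X ^ n * (X + 1) ^ m) := by
    simp only [taylor_mul, taylor_pow, taylor_X, map_sub, taylor_one, C_1, map_pow, map_neg]
    rw [sub_add_cancel_right, neg_pow]
    ring
  rw [ht, coeff_C_mul, coeff_X_pow_mul', coeff_X_add_one_pow]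
  congr 1
  split_ifs with h
  · rw [show m + n - j - n = m - j by omega, Nat.choose_symm (by omega)]
  · rw [Nat.choose_eq_zero_of_lt (by omega), Nat.cast_zero]

theorem poch_neg_natCast (m j : ℕ) :
    poch (-(m : ℂ)) j = (-1) ^ j * ((j ! : ℂ) * (m.choose j : ℂ)) := by
  rw [poch, ascPochhammer_eval_neg_eq_descPochhammer, descPochhammer_eval_eq_descFactorial,
    Nat.descFactorial_eq_factorial_mul_choose]
  push_cast
  rfl

/-- **Obreschkoff's two-point Taylor formula** on `[0, 1]`, for a sequence `f` of functions each of
which is the derivative of the preceding one. -/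
theorem obreschkoff_formula (m n : ℕ) (f : ℕ → ℝ → ℂ)
    (hf : ∀ j, ∀ x ∈ Set.Icc (0 : ℝ) 1, HasDerivAt (f j) (f (j + 1) x) x) :
    (1 / ((m + n)! : ℂ)) * ∫ x in (0 : ℝ)..1, (x : ℂ) ^ m * (1 - (x : ℂ)) ^ n * f (m + n + 1) x =
      (-1) ^ m * ∑ j ∈ Finset.range (m + n + 1), 1 / (j ! : ℂ) *
        ((-1) ^ j * (poch (-(m : ℂ)) j / poch (-(n : ℂ) - m) j) * f j 1 -
          poch (-(n : ℂ)) j / poch (-(n : ℂ) - m) j * f j 0) := by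
  have h := integral_polynomial_mul_deriv_chain (m + n)
    (Polynomial.X ^ m * (1 - Polynomial.X) ^ n) (by compute_degree) f hf
  simp only [Polynomial.eval_mul, Polynomial.eval_pow, Polynomial.eval_X, Polynomial.eval_sub,
    Polynomial.eval_one] at h
  rw [h, Finset.mul_sum, Finset.mul_sum]
  refine Finset.sum_congr rfl fun j hj => ?_
  have hj : j ≤ m + n := Nat.lt_succ_iff.1 (Finset.mem_range.1 hj)
  rw [eval_zero_iterate_derivative_beta hj, eval_one_iterate_derivative_beta hj,
    show (-(n : ℂ) - m) = -((m + n : ℕ) : ℂ) by push_cast; ring,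
    poch_neg_natCast, poch_neg_natCast, poch_neg_natCast, Nat.cast_choose ℂ hj]
  have h1 : ((-1 : ℂ) ^ (m + n - j)) = (-1) ^ m * (-1) ^ n * (-1) ^ j := by
    rw [← pow_add, ← pow_add, show m + n + j = m + n - j + 2 * j by omega, pow_add, pow_mul]
    simp
  have h2 := neg_one_pow_mul_self n
  have h3 := neg_one_pow_mul_self j
  have hj0 : (j ! : ℂ) ≠ 0 := by exact_mod_cast j.factorial_ne_zero
  have hN0 : ((m + n)! : ℂ) ≠ 0 := by exact_mod_cast (m + n).factorial_ne_zero
  have hd0 : ((m + n - j)! : ℂ) ≠ 0 := by exact_mod_cast (m + n - j).factorial_ne_zero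
  have hm1 : ((-1 : ℂ) ^ j) ≠ 0 := pow_ne_zero _ (by norm_num)
  rw [h1, pow_add]
  field_simp
  linear_combination (f j 1 * (-1) ^ j * (m.choose j : ℂ) - f j 0 * (n.choose j : ℂ)) * h2
    - f j 0 * (n.choose j : ℂ) * (-1) ^ n * (-1) ^ n * h3

/-! ### Obreschkoff's formula summed over the Hurwitz series -/

/-- Successive derivatives in `x`, the first being `(z + x) ^ (1 - σ) / (1 - σ)`, and the one of
order `j + 1` being `(-1) ^ j (σ)_j (z + x) ^ (-(σ + j))`. The case of index `0` is meaningful only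
for `σ ≠ 1`. -/
noncomputable def cpowChain (σ z : ℂ) : ℕ → ℝ → ℂ
  | 0, x => (z + x) ^ (1 - σ) / (1 - σ)
  | j + 1, x => (-1) ^ j * poch σ j * (1 / (z + x) ^ (σ + j))

theorem poch_succ (x : ℂ) (j : ℕ) : poch x (j + 1) = poch x j * (x + j) := by
  simp [poch, ascPochhammer_succ_right]

theorem hasDerivAt_cpowChain {σ z : ℂ} (hσ : σ ≠ 1) (hz : 0 < z.re) (j : ℕ) {x : ℝ}
    (hx : x ∈ Set.Icc (0 : ℝ) 1) :
    HasDerivAt (cpowChain σ z j) (cpowChain σ z (j + 1) x) x := by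
  have hs : z + (x : ℂ) ∈ Complex.slitPlane := by
    left
    have := hx.1
    simp
    linarith
  have hd : ∀ c : ℂ, HasDerivAt (fun y : ℝ => (z + (y : ℂ)) ^ c)
      (c * (z + (x : ℂ)) ^ (c - 1)) x := fun c => by
    have h1 : HasDerivAt (fun w : ℂ => (z + w) ^ c) (c * (z + (x : ℂ)) ^ (c - 1) * 1) (x : ℂ) :=
      ((hasDerivAt_id (x : ℂ)).const_add z).cpow_const hs
    rw [mul_one] at h1
    exact h1.comp_ofReal
  cases j with
  | zero =>
    have h := (hd (1 - σ)).div_const (1 - σ)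
    have h1 : (1 - σ) ≠ 0 := sub_ne_zero.2 hσ.symm
    refine h.congr_deriv ?_
    simp only [cpowChain, poch, ascPochhammer_zero, Polynomial.eval_one, pow_zero, Nat.cast_zero,
      add_zero, one_mul]
    rw [mul_div_cancel_left₀ _ h1, one_div, ← Complex.cpow_neg, sub_sub_cancel_left]
  | succ j =>
    have h := (hd (-(σ + j))).const_mul ((-1) ^ j * poch σ j)
    simp only [Complex.cpow_neg _ (σ + j), ← one_div] at h
    refine h.congr_deriv ?_
    simp only [cpowChain, poch_succ, pow_succ]
    rw [show -(σ + j) - 1 = -(σ + ((j + 1 : ℕ) : ℂ)) by push_cast; ring, Complex.cpow_neg, one_div]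
    ring

theorem tendsto_natCast_add_cpow {w a : ℂ} (hw : w.re < 0) (ha : 0 < a.re) :
    Tendsto (fun k : ℕ => ((k : ℂ) + a) ^ w) atTop (𝓝 0) := by
  have hnorm : Tendsto (fun k : ℕ => ‖(k : ℂ) + a‖) atTop atTop := by
    refine tendsto_atTop_mono (fun k => ?_) tendsto_natCast_atTop_atTop
    refine le_trans ?_ (Complex.re_le_norm _)
    simp [ha.le]
  have h0 : Tendsto (fun k : ℕ => ‖(k : ℂ) + a‖ ^ w.re * Real.exp (Real.pi * |w.im|)) atTop
      (𝓝 0) := by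
    have := ((tendsto_rpow_neg_atTop (neg_pos.2 hw)).comp hnorm).mul_const
      (Real.exp (Real.pi * |w.im|))
    simpa [Function.comp_def] using this
  refine squeeze_zero_norm (fun k => ?_) h0
  rw [Complex.norm_cpow_of_ne_zero (natCast_add_ne_zero_of_re_pos ha k), div_eq_mul_inv,
    ← Real.exp_neg]
  refine mul_le_mul_of_nonneg_left (Real.exp_le_exp.2 ?_) (by positivity)
  calc -(Complex.arg _ * w.im) ≤ |Complex.arg _ * w.im| := neg_le_abs _
    _ = |Complex.arg _| * |w.im| := abs_mul _ _
    _ ≤ _ := mul_le_mul_of_nonneg_right (Complex.abs_arg_le_pi _) (abs_nonneg _)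

theorem re_add_ofReal_pos {a : ℂ} (ha : 0 < a.re) {x : ℝ} (hx : x ∈ Set.Icc (0 : ℝ) 1) :
    0 < (a + (x : ℂ)).re := by
  have := hx.1
  simp
  linarith

theorem hasSum_integral_hurwitzSeries {s a : ℂ} (hs : 1 < s.re) (ha : 0 < a.re) {u : ℝ → ℂ}
    (hu : Continuous u) :
    HasSum (fun k : ℕ => ∫ x in (0 : ℝ)..1, u x * (1 / ((k : ℂ) + (a + x)) ^ s))
      (∫ x in (0 : ℝ)..1, u x * hurwitzSeries s (a + x)) := by
  have hsub : Set.uIoc (0 : ℝ) 1 ⊆ Set.Icc 0 1 := by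
    rw [Set.uIoc_of_le zero_le_one]; exact Set.Ioc_subset_Icc_self
  have hcont : ∀ k : ℕ, ContinuousOn (fun x : ℝ => u x * (1 / ((k : ℂ) + (a + x)) ^ s))
      (Set.Icc 0 1) := fun k =>
    hu.continuousOn.mul ((continuousOn_one_div_cpow k).comp (f := fun x : ℝ => (a + (x : ℂ), s))
      (by fun_prop) fun x hx => ⟨re_add_ofReal_pos ha hx, trivial⟩)
  obtain ⟨C₀, hC₀⟩ := isCompact_Icc.exists_bound_of_continuousOn (hcont 0)
  obtain ⟨C, hC⟩ := isCompact_Icc.exists_bound_of_continuousOn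
    (hu.continuousOn (s := Set.Icc (0 : ℝ) 1))
  have hC' : 0 ≤ C := (norm_nonneg _).trans (hC 0 (by simp))
  -- The term `k = 0` is bounded by compactness, the others by the uniform majorant.
  let g : ℕ → ℝ := fun k => Nat.casesOn k C₀ fun k =>
    C * (Real.exp (Real.pi * |s.im|) * (1 / ((k + 1 : ℕ) : ℝ) ^ s.re))
  have hg : Summable g := (summable_nat_add_iff 1).1
    ((summable_const_mul_one_div_succ_rpow hs _).mul_left C)
  refine intervalIntegral.hasSum_integral_of_dominated_convergence (fun k _ => g k)
    (fun k => ((hcont k).mono hsub).aestronglyMeasurable measurableSet_uIoc) (fun k => ?_)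
    (Eventually.of_forall fun _ _ => hg) (by simp) (Eventually.of_forall fun x hx => ?_)
  · refine Eventually.of_forall fun x hx => ?_
    cases k with
    | zero => exact hC₀ x (hsub hx)
    | succ k =>
      rw [norm_mul]
      exact mul_le_mul (hC x (hsub hx)) (norm_one_div_cpow_le (by linarith) le_rfl le_rfl
        (re_add_ofReal_pos ha (hsub hx)) k) (norm_nonneg _) hC'
  · exact ((summable_hurwitzSeries hs (re_add_ofReal_pos ha (hsub hx))).hasSum).mul_left _

/-- The sum over `z = k + a`, `k ≥ 0`, of Obreschkoff's formula for `(z + x) ^ (1 - σ) / (1 - σ)`.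
The term of order `0` telescopes; in the others the values at `x = 1` are those at `x = 0` with
`k` shifted by one. -/
theorem obreschkoff_hurwitzSeries {m n : ℕ} {σ a : ℂ} (hσ : 1 < σ.re) (ha : 0 < a.re) :
    (1 / ((m + n)! : ℂ)) * ((-1) ^ (m + n) * poch σ (m + n) *
        ∫ x in (0 : ℝ)..1, (x : ℂ) ^ m * (1 - (x : ℂ)) ^ n *
          hurwitzSeries (σ + ((m + n : ℕ) : ℂ)) (a + x)) =
      (-1) ^ m * (a ^ (1 - σ) / (σ - 1) + ∑ j ∈ Finset.range (m + n), 1 / ((j + 1)! : ℂ) *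
        ((-1) ^ j * poch σ j *
          ((-1) ^ (j + 1) * (poch (-(m : ℂ)) (j + 1) / poch (-(n : ℂ) - m) (j + 1)) *
            (hurwitzSeries (σ + j) a - 1 / a ^ (σ + j)) -
          poch (-(n : ℂ)) (j + 1) / poch (-(n : ℂ) - m) (j + 1) * hurwitzSeries (σ + j) a))) := by
  have hσ1 : σ ≠ 1 := fun h => by simp [h] at hσ
  have hre : ∀ j : ℕ, 1 < (σ + (j : ℂ)).re := fun j => by
    have : (0 : ℝ) ≤ j := j.cast_nonneg
    simp
    linarith
  have hka : ∀ k : ℕ, 0 < ((k : ℂ) + a).re := fun k => by simp; positivity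
  have hterm := fun k : ℕ => obreschkoff_formula m n (cpowChain σ (k + a))
    fun j x hx => hasDerivAt_cpowChain hσ1 (hka k) j hx
  have hsum : ∀ j : ℕ, HasSum (fun k : ℕ => 1 / ((k : ℂ) + a) ^ (σ + j))
      (hurwitzSeries (σ + j) a) := fun j => (summable_hurwitzSeries (hre j) ha).hasSum
  have hsum1 : ∀ j : ℕ, HasSum (fun k : ℕ => 1 / ((k : ℂ) + a + 1) ^ (σ + j))
      (hurwitzSeries (σ + j) a - 1 / a ^ (σ + j)) := fun j => by
    rw [← hurwitzSeries_add_one (hre j) ha]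
    simp only [add_assoc]
    exact (summable_hurwitzSeries (hre j) (b := a + 1) (by simp; linarith)).hasSum
  have hint := ((hasSum_integral_hurwitzSeries (hre (m + n)) ha
    (u := fun x : ℝ => (x : ℂ) ^ m * (1 - (x : ℂ)) ^ n) (by fun_prop)).mul_left
      ((-1) ^ (m + n) * poch σ (m + n))).mul_left (1 / ((m + n)! : ℂ))
  have hfin := hasSum_sum (s := Finset.range (m + n)) fun j _ =>
    ((((hsum1 j).mul_left
      ((-1) ^ (j + 1) * (poch (-(m : ℂ)) (j + 1) / poch (-(n : ℂ) - m) (j + 1)))).sub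
      ((hsum j).mul_left (poch (-(n : ℂ)) (j + 1) / poch (-(n : ℂ) - m) (j + 1)))).mul_left
        ((-1) ^ j * poch σ j)).mul_left (1 / ((j + 1)! : ℂ))
  -- By Obreschkoff's formula, the terms of this combination of convergent series are the increments
  -- of `K ↦ cpowChain σ (K + a) 0 0`, which tends to `0`.
  have htele := ((hint.mul_left ((-1) ^ m)).sub hfin).tendsto_sum_nat
  have hm2 := neg_one_pow_mul_self m
  have hstep : ∀ k : ℕ, (-1) ^ m * (1 / ((m + n)! : ℂ) * ((-1) ^ (m + n) * poch σ (m + n) *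
        ∫ x in (0 : ℝ)..1, (x : ℂ) ^ m * (1 - (x : ℂ)) ^ n *
          (1 / ((k : ℂ) + (a + x)) ^ (σ + ((m + n : ℕ) : ℂ))))) -
      (∑ j ∈ Finset.range (m + n), 1 / ((j + 1)! : ℂ) * ((-1) ^ j * poch σ j *
        ((-1) ^ (j + 1) * (poch (-(m : ℂ)) (j + 1) / poch (-(n : ℂ) - m) (j + 1)) *
            (1 / ((k : ℂ) + a + 1) ^ (σ + j)) -
          poch (-(n : ℂ)) (j + 1) / poch (-(n : ℂ) - m) (j + 1) *
            (1 / ((k : ℂ) + a) ^ (σ + j))))) =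
      cpowChain σ ((k + 1 : ℕ) + a) 0 0 - cpowChain σ (k + a) 0 0 := fun k => by
    have h := hterm k
    have hI : ∫ x in (0 : ℝ)..1, (x : ℂ) ^ m * (1 - (x : ℂ)) ^ n *
          cpowChain σ (k + a) (m + n + 1) x = (-1) ^ (m + n) * poch σ (m + n) *
        ∫ x in (0 : ℝ)..1, (x : ℂ) ^ m * (1 - (x : ℂ)) ^ n *
          (1 / ((k : ℂ) + (a + x)) ^ (σ + ((m + n : ℕ) : ℂ))) := by
      rw [← intervalIntegral.integral_const_mul]
      refine intervalIntegral.integral_congr fun x _ => ?_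
      simp only [cpowChain, add_assoc]
      ring
    have h0 : cpowChain σ ((k + 1 : ℕ) + a) 0 0 = cpowChain σ (k + a) 0 1 := by
      simp only [cpowChain]
      push_cast
      rw [add_zero, add_right_comm]
    rw [Finset.sum_range_succ', hI] at h
    rw [h, h0, ← mul_assoc, hm2, one_mul, add_sub_right_comm]
    simp only [cpowChain, poch, Complex.ofReal_one, Complex.ofReal_zero, add_zero, pow_zero,
      Nat.factorial_zero, Nat.cast_one, one_mul, div_one, ascPochhammer_zero, Polynomial.eval_one,
      add_eq_right, sub_eq_zero]
    refine Finset.sum_congr rfl fun j _ => ?_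
    ring
  have hlim : Tendsto (fun K : ℕ => cpowChain σ (K + a) 0 0 - cpowChain σ (((0 : ℕ) : ℂ) + a) 0 0)
      atTop (𝓝 (0 / (1 - σ) - cpowChain σ (((0 : ℕ) : ℂ) + a) 0 0)) := by
    refine Tendsto.sub_const ?_ _
    simp only [cpowChain, Complex.ofReal_zero, add_zero]
    exact (tendsto_natCast_add_cpow (by simp; linarith) ha).div_const _
  simp only [hstep] at htele
  simp only [Finset.sum_range_sub (fun K : ℕ => cpowChain σ (K + a) 0 0)] at htele
  have hV := tendsto_nhds_unique htele hlim
  have hF : 0 / (1 - σ) - cpowChain σ (((0 : ℕ) : ℂ) + a) 0 0 = a ^ (1 - σ) / (σ - 1) := by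
    simp only [cpowChain, Complex.ofReal_zero, add_zero, Nat.cast_zero, zero_add, zero_div, zero_sub]
    rw [← div_neg, neg_sub]
  rw [hF] at hV
  rw [← hV, sub_add_cancel, ← mul_assoc _ _ (1 / _ * _), hm2, one_mul]

/-! ### Uniqueness of the continuation and of the Stieltjes constants -/

/-- Two continuations agree wherever both are defined. The identity theorem is applied on a convex
set rather than on the punctured half-plane. -/
theorem IsHurwitzContinuation.eq_of_lt_re {a : ℂ} {c c' : ℝ} {Z Z' : ℂ → ℂ}
    (h : IsHurwitzContinuation a c Z) (h' : IsHurwitzContinuation a c' Z') {σ : ℂ} (hσ : σ ≠ 1)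
    (hc : c < σ.re) (hc' : c' < σ.re) : Z σ = Z' σ := by
  by_cases hre : 1 < σ.re
  · rw [h.eq_series σ hre, h'.eq_series σ hre]
  obtain ⟨ε, hε, hεσ⟩ : ∃ ε : ℝ, |ε| = 1 ∧ σ.re - 1 < ε * σ.im := by
    by_cases him : σ.im = 0
    · refine ⟨1, by simp, ?_⟩
      have : σ.re ≠ 1 := fun h1 => hσ (Complex.ext h1 him)
      have := lt_of_le_of_ne (not_lt.1 hre) this
      rw [him]; linarith
    · rcases lt_or_gt_of_ne him with h1 | h1
      · exact ⟨-1, by simp, by linarith⟩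
      · exact ⟨1, by simp, by linarith⟩
  have hε2 : ε * ε = 1 := by rw [← abs_mul_abs_self, hε, one_mul]
  -- `U` is the part of the half-plane to one side of a slanted line through `1`. It avoids the pole,
  -- contains `σ`, and meets `Re s > 1` in `2 + 2 ε i`.
  let U : Set ℂ := {s | max c c' < s.re ∧ s.re - 1 < ε * s.im}
  have hUo : IsOpen U := (isOpen_re_lt_right _).inter
    (isOpen_lt (Complex.continuous_re.sub continuous_const)
      (continuous_const.mul Complex.continuous_im))
  have hUc : Convex ℝ U := by
    intro s hs t ht p q hp hq hpq
    have hq' : q = 1 - p := by linarith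
    subst hq'
    have h1 := hs.1
    have h2 := ht.1
    have h3 := hs.2
    have h4 := ht.2
    refine ⟨?_, ?_⟩
    · have := (convex_Ioi (max c c')) (x := s.re) h1 (y := t.re) h2 hp hq hpq
      simpa using this
    · have := (convex_Ioi (0 : ℝ)) (x := ε * s.im - (s.re - 1)) (by simpa using h3)
        (y := ε * t.im - (t.re - 1)) (by simpa using h4) hp hq hpq
      simp only [smul_eq_mul, Set.mem_Ioi] at this
      simp
      linarith
  have hU1 : ∀ s ∈ U, s ≠ 1 := by
    rintro s hs rfl
    have := hs.2
    simp at this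
  have hcl : c < 1 := hc.trans_le (not_lt.1 hre)
  have hcl' : c' < 1 := hc'.trans_le (not_lt.1 hre)
  have hpU : (⟨2, 2 * ε⟩ : ℂ) ∈ U :=
    ⟨max_lt (by simp; linarith) (by simp; linarith), by simp; nlinarith⟩
  have hA : AnalyticOnNhd ℂ Z U := (h.differentiableOn.mono fun s hs =>
    ⟨(le_max_left _ _).trans_lt hs.1, hU1 s hs⟩).analyticOnNhd hUo
  have hA' : AnalyticOnNhd ℂ Z' U := (h'.differentiableOn.mono fun s hs =>
    ⟨(le_max_right _ _).trans_lt hs.1, hU1 s hs⟩).analyticOnNhd hUo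
  refine hA.eqOn_of_preconnected_of_eventuallyEq hA' hUc.isPreconnected hpU ?_
    (show σ ∈ U from ⟨max_lt hc hc', hεσ⟩)
  filter_upwards [(isOpen_re_lt_right 1).mem_nhds (show (1 : ℝ) < (⟨2, 2 * ε⟩ : ℂ).re by simp)]
    with s hs
  rw [h.eq_series s hs, h'.eq_series s hs]

theorem IsHurwitzContinuation.hurwitzZetaC_eq {a : ℂ} {c : ℝ} {Z : ℂ → ℂ}
    (h : IsHurwitzContinuation a c Z) {σ : ℂ} (hσ : σ ≠ 1) (hc : c < σ.re) :
    hurwitzZetaC σ a = Z σ := by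
  have hex : σ ≠ 1 ∧ ∃ w : ℂ, ∃ c : ℝ, ∃ Z : ℂ → ℂ,
      c < σ.re ∧ IsHurwitzContinuation a c Z ∧ w = Z σ := ⟨hσ, _, c, Z, hc, h, rfl⟩
  rw [hurwitzZetaC, dif_pos hex]
  obtain ⟨c', Z', hc', h', hw⟩ := Classical.choose_spec hex.2
  rw [hw]
  exact h'.eq_of_lt_re h hσ hc' hc

theorem hurwitzZetaC_eq_hurwitzSeries {σ a : ℂ} (hσ : 1 < σ.re) (ha : 0 < a.re) :
    hurwitzZetaC σ a = hurwitzSeries σ a := by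
  have h : IsHurwitzContinuation a 1 fun s => hurwitzSeries s a :=
    ⟨(differentiableOn_hurwitzSeries ha).mono fun s hs => hs.1, fun _ _ => rfl⟩
  exact h.hurwitzZetaC_eq (fun h => by simp [h] at hσ) hσ

theorem hurwitzZetaDeriv_eq_iteratedDeriv_hurwitzSeries (r : ℕ) {σ a : ℂ} (hσ : 1 < σ.re)
    (ha : 0 < a.re) :
    hurwitzZetaDeriv r σ a = iteratedDeriv r (fun s => hurwitzSeries s a) σ := by
  refine Filter.EventuallyEq.iteratedDeriv_eq r ?_
  filter_upwards [(isOpen_re_lt_right 1).mem_nhds hσ] with s hs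
  exact hurwitzZetaC_eq_hurwitzSeries hs ha

/-- Any sequence of Laurent coefficients is given by the Taylor coefficients of a function `G` that
extends `ζ(σ, a) - 1 / (σ - 1)` analytically to `1`; in particular it is unique. -/
theorem IsStieltjesSeq.neg_one_pow_mul_eq_iteratedDeriv {a : ℂ} {γ : ℕ → ℂ}
    (h : IsStieltjesSeq a γ) {G : ℂ → ℂ} (hG : AnalyticAt ℂ G 1)
    (hζ : ∀ᶠ σ in 𝓝[≠] 1, hurwitzZetaC σ a - 1 / (σ - 1) = G σ) (ℓ : ℕ) :
    (-1) ^ ℓ * γ ℓ = iteratedDeriv ℓ G 1 := by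
  obtain ⟨r, hr, hsum⟩ := h
  let c : ℕ → ℂ := fun ℓ => (-1) ^ ℓ / (ℓ ! : ℂ) * γ ℓ
  -- `g` has the given expansion on a full neighbourhood of `1`, thanks to its value `c 0` at `1`.
  let g : ℂ → ℂ := fun σ => if σ = 1 then c 0 else hurwitzZetaC σ a - 1 / (σ - 1)
  have hg : HasFPowerSeriesAt g (FormalMultilinearSeries.ofScalars ℂ c) 1 := by
    rw [hasFPowerSeriesAt_iff]
    filter_upwards [Metric.ball_mem_nhds (0 : ℂ) hr] with z hz
    simp only [FormalMultilinearSeries.coeff_ofScalars, smul_eq_mul]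
    by_cases hz0 : z = 0
    · subst hz0
      simpa [g] using hasSum_single (f := fun n : ℕ => (0 : ℂ) ^ n * c n) 0
        fun n hn => by simp [hn]
    · have hz1 : (1 : ℂ) + z ≠ 1 := by simpa using hz0
      have := hsum (1 + z) hz1 (by simpa using hz)
      simp only [g, if_neg hz1]
      simpa [c, mul_comm] using this
  have hgG : g =ᶠ[𝓝 1] G := by
    refine (hg.continuousAt.eventuallyEq_nhds_iff_eventuallyEq_nhdsNE hG.continuousAt).1 ?_
    filter_upwards [hζ, self_mem_nhdsWithin] with σ h1 h2
    exact (if_neg h2).trans h1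
  have heq := (hg.congr hgG).eq_formalMultilinearSeries hG.hasFPowerSeriesAt
  have hc : c ℓ = iteratedDeriv ℓ G 1 / (ℓ ! : ℂ) := by
    simpa only [FormalMultilinearSeries.coeff_ofScalars] using
      congrArg (fun p => FormalMultilinearSeries.coeff p ℓ) heq
  have hℓ : (ℓ ! : ℂ) ≠ 0 := by exact_mod_cast ℓ.factorial_ne_zero
  rw [eq_div_iff hℓ] at hc
  rw [← hc]
  simp only [c]
  field_simp

/-- The hypotheses also give the existence of the Laurent expansion, so that `stieltjesConst` does
not take its default value. -/
theorem neg_one_pow_mul_stieltjesConst {a : ℂ} {G : ℂ → ℂ} {ρ : ℝ} (hρ : 0 < ρ)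
    (hG : DifferentiableOn ℂ G (Metric.ball 1 ρ))
    (hζ : ∀ σ ∈ Metric.ball (1 : ℂ) ρ, σ ≠ 1 → hurwitzZetaC σ a - 1 / (σ - 1) = G σ) (ℓ : ℕ) :
    (-1) ^ ℓ * stieltjesConst ℓ a = iteratedDeriv ℓ G 1 := by
  have hex : ∃ γ : ℕ → ℂ, IsStieltjesSeq a γ := by
    refine ⟨fun ℓ => (-1) ^ ℓ * iteratedDeriv ℓ G 1, ρ, hρ, fun σ hσ hσρ => ?_⟩
    have hmem : σ ∈ Metric.ball (1 : ℂ) ρ := by rwa [mem_ball_iff_norm]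
    rw [hζ σ hmem hσ]
    have hfun : (fun ℓ : ℕ => (-1) ^ ℓ / (ℓ ! : ℂ) * ((-1) ^ ℓ * iteratedDeriv ℓ G 1) *
        (σ - 1) ^ ℓ) = fun ℓ : ℕ => (ℓ ! : ℂ)⁻¹ • (σ - 1) ^ ℓ • iteratedDeriv ℓ G 1 := by
      funext ℓ
      have h1 := neg_one_pow_mul_self ℓ
      simp only [smul_eq_mul]
      linear_combination ((ℓ ! : ℂ)⁻¹ * (σ - 1) ^ ℓ * iteratedDeriv ℓ G 1) * h1
    rw [hfun]
    exact Complex.hasSum_taylorSeries_on_ball hG hmem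
  rw [stieltjesConst, dif_pos hex]
  refine (Classical.choose_spec hex).neg_one_pow_mul_eq_iteratedDeriv
    (hG.analyticAt (Metric.ball_mem_nhds 1 hρ)) ?_ ℓ
  filter_upwards [self_mem_nhdsWithin, nhdsWithin_le_nhds (Metric.ball_mem_nhds 1 hρ)] with σ h1 h2
  exact hζ σ h2 h1

/-! ### Continuation of the Hurwitz zeta function to `Re σ > 0` -/

theorem poch_neg_eq_zero_of_lt {m j : ℕ} (h : m < j) : poch (-(m : ℂ)) j = 0 := by
  rw [poch_neg_natCast, Nat.choose_eq_zero_of_lt h]; simp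

/-- What Obreschkoff's formula leaves of `ζ(σ, a)` beyond `a ^ (1 - σ) / (σ - 1)`. Only values of the
Hurwitz series at arguments of real part at least `Re σ + 1` occur, so it is holomorphic for
`Re σ > 0`. The subtractions `j - 1` are in `ℕ`, with `j ≥ 1`. -/
noncomputable def obreschkoffRegularPart (m n : ℕ) (a σ : ℂ) : ℂ :=
  ∑ j ∈ Finset.Icc 1 m, poch (-(m : ℂ)) j / poch (-(n : ℂ) - m) j * (a ^ (-(j : ℤ)) / (j ! : ℂ)) *
      (poch σ (j - 1) * a ^ (1 - σ)) -
    ∑ j ∈ Finset.Icc 2 (max m n),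
      (poch (-(m : ℂ)) j - (-1) ^ j * poch (-(n : ℂ)) j) / poch (-(n : ℂ) - m) j * (1 / (j ! : ℂ)) *
        (poch σ (j - 1) * hurwitzSeries (σ + ((j - 1 : ℕ) : ℂ)) a) -
    (-1) ^ n / ((m + n)! : ℂ) * (poch σ (m + n) *
      ∫ x in (0 : ℝ)..1, (x : ℂ) ^ m * (1 - (x : ℂ)) ^ n *
        hurwitzSeries (σ + ((m + n : ℕ) : ℂ)) (a + x))

theorem hurwitzSeries_eq_add_obreschkoffRegularPart {m n : ℕ} (hmn : 1 ≤ m + n) {σ a : ℂ}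
    (hσ : 1 < σ.re) (ha : 0 < a.re) :
    hurwitzSeries σ a = a ^ (1 - σ) / (σ - 1) + obreschkoffRegularPart m n a σ := by
  have ha0 : a ≠ 0 := fun h => by simp [h] at ha
  have h := obreschkoff_hurwitzSeries (m := m) (n := n) hσ ha
  let A : ℕ → ℂ := fun j => poch (-(m : ℂ)) j / poch (-(n : ℂ) - m) j * (a ^ (-(j : ℤ)) / (j ! : ℂ)) *
      (poch σ (j - 1) * a ^ (1 - σ))
  let C : ℕ → ℂ := fun j => (poch (-(m : ℂ)) j - (-1) ^ j * poch (-(n : ℂ)) j) /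
    poch (-(n : ℂ) - m) j * (1 / (j ! : ℂ)) *
        (poch σ (j - 1) * hurwitzSeries (σ + ((j - 1 : ℕ) : ℂ)) a)
  have hsum : (∑ j ∈ Finset.range (m + n), 1 / ((j + 1)! : ℂ) *
        ((-1) ^ j * poch σ j *
          ((-1) ^ (j + 1) * (poch (-(m : ℂ)) (j + 1) / poch (-(n : ℂ) - m) (j + 1)) *
            (hurwitzSeries (σ + j) a - 1 / a ^ (σ + j)) -
          poch (-(n : ℂ)) (j + 1) / poch (-(n : ℂ) - m) (j + 1) * hurwitzSeries (σ + j) a))) =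
      ∑ j ∈ Finset.Icc 1 (m + n), (A j - C j) := by
    rw [Finset.range_eq_Ico, Finset.sum_Ico_eq_sum_range, ← Finset.Ico_add_one_right_eq_Icc,
      Finset.sum_Ico_eq_sum_range]
    refine Finset.sum_congr (by simp) fun j _ => ?_
    have hpow : 1 / a ^ (σ + j) = a ^ (-((j + 1 : ℕ) : ℤ)) * a ^ (1 - σ) := by
      rw [one_div, ← Complex.cpow_neg, ← Complex.cpow_intCast, ← Complex.cpow_add _ _ ha0]
      congr 1
      push_cast
      ring
    simp only [A, C, zero_add, add_comm 1 j, Nat.add_sub_cancel, hpow, pow_succ]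
    linear_combination (-(1 / ((j + 1)! : ℂ) * poch σ j *
          ((poch (-(m : ℂ)) (j + 1) / poch (-(n : ℂ) - m) (j + 1)) *
            (hurwitzSeries (σ + j) a - a ^ (-((j + 1 : ℕ) : ℤ)) * a ^ (1 - σ))))) *
              neg_one_pow_mul_self j
  have hA : ∑ j ∈ Finset.Icc 1 (m + n), A j = ∑ j ∈ Finset.Icc 1 m, A j := by
    refine (Finset.sum_subset (Finset.Icc_subset_Icc_right (by omega)) fun j hj hj' => ?_).symm
    simp only [Finset.mem_Icc] at hj hj'
    simp only [A, poch_neg_eq_zero_of_lt (show m < j by omega)]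
    simp
  -- For `j = 1` the coefficient is `(-m - n) / (-n - m) = 1`, which isolates `ζ(σ, a)`.
  have hC : ∑ j ∈ Finset.Icc 1 (m + n), C j = hurwitzSeries σ a +
      ∑ j ∈ Finset.Icc 2 (max m n), C j := by
    rw [← Finset.add_sum_Ioc_eq_sum_Icc hmn]
    congr 1
    · have hne : (-(n : ℂ) - m) ≠ 0 := by
        have : ((m + n : ℕ) : ℂ) ≠ 0 := by exact_mod_cast (show m + n ≠ 0 by omega)
        intro h
        apply this
        push_cast
        linear_combination -h
      simp only [C, poch, ascPochhammer_one, ascPochhammer_zero, Nat.sub_self, Nat.cast_zero,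
        add_zero, Polynomial.eval_X, Polynomial.eval_one, pow_one, Nat.factorial_one, Nat.cast_one]
      rw [show (-(m : ℂ) - -1 * -(n : ℂ)) = -(n : ℂ) - m by ring, div_self hne]
      simp
    · refine (Finset.sum_subset (fun j hj => ?_) fun j hj hj' => ?_).symm
      · simp only [Finset.mem_Icc, Finset.mem_Ioc] at hj ⊢
        omega
      · simp only [Finset.mem_Icc, Finset.mem_Ioc] at hj hj'
        simp only [C, poch_neg_eq_zero_of_lt (show m < j by omega),
          poch_neg_eq_zero_of_lt (show n < j by omega)]
        simp
  rw [hsum, Finset.sum_sub_distrib, hA, hC] at h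
  simp only [obreschkoffRegularPart]
  change _ = _ + (∑ j ∈ Finset.Icc 1 m, A j - ∑ j ∈ Finset.Icc 2 (max m n), C j - _)
  rw [pow_add] at h
  have hm := neg_one_pow_mul_self m
  set I := ∫ x in (0 : ℝ)..1, (x : ℂ) ^ m * (1 - (x : ℂ)) ^ n *
          hurwitzSeries (σ + ((m + n : ℕ) : ℂ)) (a + x)
  linear_combination (-1) ^ m * h - ((-1) ^ n / ((m + n)! : ℂ) * poch σ (m + n) * I -
    (a ^ (1 - σ) / (σ - 1) + (∑ j ∈ Finset.Icc 1 m, A j - (hurwitzSeries σ a +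
      ∑ j ∈ Finset.Icc 2 (max m n), C j)))) * hm

theorem differentiable_poch (j : ℕ) : Differentiable ℂ fun σ => poch σ j :=
  (ascPochhammer ℂ j).differentiable

theorem continuousOn_beta_mul_hurwitzSeries (m n : ℕ) {a : ℂ} (ha : 0 < a.re) :
    ContinuousOn (fun p : ℝ × ℂ => (p.1 : ℂ) ^ m * (1 - (p.1 : ℂ)) ^ n *
      hurwitzSeries p.2 (a + p.1)) (Set.Icc 0 1 ×ˢ {s | 1 < s.re}) := by
  refine ContinuousOn.mul (by fun_prop) (continuousOn_hurwitzSeries_uncurry.comp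
    (f := fun p : ℝ × ℂ => (a + (p.1 : ℂ), p.2)) (by fun_prop) ?_)
  rintro ⟨x, s⟩ ⟨hx, hs⟩
  exact ⟨re_add_ofReal_pos ha hx, hs⟩

theorem differentiableOn_beta_mul_hurwitzSeries (m n : ℕ) {a : ℂ} (ha : 0 < a.re) :
    ∀ x ∈ Set.Icc (0 : ℝ) 1, DifferentiableOn ℂ (fun s => (x : ℂ) ^ m * (1 - (x : ℂ)) ^ n *
      hurwitzSeries s (a + x)) {s | 1 < s.re} := fun _ hx =>
  (differentiableOn_hurwitzSeries (re_add_ofReal_pos ha hx)).const_mul _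

theorem iteratedDeriv_beta_mul_hurwitzSeries (r m n : ℕ) {s a : ℂ} (hs : 1 < s.re)
    (ha : 0 < a.re) {x : ℝ} (hx : x ∈ Set.Icc (0 : ℝ) 1) :
    iteratedDeriv r (fun s => (x : ℂ) ^ m * (1 - (x : ℂ)) ^ n * hurwitzSeries s (a + x)) s =
      (x : ℂ) ^ m * (1 - (x : ℂ)) ^ n * hurwitzZetaDeriv r s (a + x) := by
  rw [iteratedDeriv_const_mul_field,
    hurwitzZetaDeriv_eq_iteratedDeriv_hurwitzSeries r hs (re_add_ofReal_pos ha hx)]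

theorem one_lt_re_add_natCast {σ : ℂ} (hσ : 0 < σ.re) {j : ℕ} (hj : 1 ≤ j) :
    1 < (σ + (j : ℂ)).re := by
  have : (1 : ℝ) ≤ j := by exact_mod_cast hj
  simp
  linarith

theorem differentiableAt_hurwitzSeries_add {σ a : ℂ} (hσ : 0 < σ.re) (ha : 0 < a.re) {j : ℕ}
    (hj : 1 ≤ j) : DifferentiableAt ℂ (fun σ => hurwitzSeries (σ + (j : ℂ)) a) σ :=
  DifferentiableAt.comp (g := fun s => hurwitzSeries s a) σ
    ((differentiableOn_hurwitzSeries ha).differentiableAt ((isOpen_re_lt_right 1).mem_nhds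
      (one_lt_re_add_natCast hσ hj))) (differentiableAt_id.add_const _)

theorem differentiableAt_integral_beta_mul_hurwitzSeries {m n : ℕ} (hmn : 1 ≤ m + n) {σ a : ℂ}
    (hσ : 0 < σ.re) (ha : 0 < a.re) :
    DifferentiableAt ℂ (fun σ => ∫ x in (0 : ℝ)..1, (x : ℂ) ^ m * (1 - (x : ℂ)) ^ n *
        hurwitzSeries (σ + ((m + n : ℕ) : ℂ)) (a + x)) σ :=
  DifferentiableAt.comp (g := fun s => ∫ x in (0 : ℝ)..1, (x : ℂ) ^ m * (1 - (x : ℂ)) ^ n *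
      hurwitzSeries s (a + x)) σ
    (hasDerivAt_integral_of_continuousOn_uncurry (isOpen_re_lt_right 1)
      (F := fun x s => (x : ℂ) ^ m * (1 - (x : ℂ)) ^ n * hurwitzSeries s (a + x))
      (continuousOn_beta_mul_hurwitzSeries m n ha) (differentiableOn_beta_mul_hurwitzSeries m n ha)
      (one_lt_re_add_natCast hσ hmn)).differentiableAt (differentiableAt_id.add_const _)

theorem differentiable_const_cpow_one_sub {a : ℂ} (ha : a ≠ 0) :
    Differentiable ℂ fun σ : ℂ => a ^ (1 - σ) := fun _ =>
  (differentiableAt_id.const_sub 1).const_cpow (Or.inl ha)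

theorem differentiableAt_obreschkoffRegularPart {m n : ℕ} (hmn : 1 ≤ m + n) {σ a : ℂ}
    (hσ : 0 < σ.re) (ha : 0 < a.re) :
    DifferentiableAt ℂ (obreschkoffRegularPart m n a) σ := by
  have ha0 : a ≠ 0 := fun h => by simp [h] at ha
  refine DifferentiableAt.sub (DifferentiableAt.sub ?_ ?_) ?_
  · exact DifferentiableAt.fun_sum fun j _ => ((differentiable_poch _ _).mul
      (differentiable_const_cpow_one_sub ha0 _)).const_mul _
  · refine DifferentiableAt.fun_sum fun j hj => ((differentiable_poch _ _).mul
      (differentiableAt_hurwitzSeries_add hσ ha ?_)).const_mul _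
    have := (Finset.mem_Icc.1 hj).1
    omega
  · exact ((differentiable_poch _ _).mul
      (differentiableAt_integral_beta_mul_hurwitzSeries hmn hσ ha)).const_mul _

/-- Obreschkoff's formula continues the Hurwitz zeta function to `Re σ > 0`. -/
theorem isHurwitzContinuation_obreschkoff {m n : ℕ} (hmn : 1 ≤ m + n) {a : ℂ} (ha : 0 < a.re) :
    IsHurwitzContinuation a 0 fun σ => a ^ (1 - σ) / (σ - 1) + obreschkoffRegularPart m n a σ where
  differentiableOn := fun σ hσ => by
    have ha0 : a ≠ 0 := fun h => by simp [h] at ha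
    have h1 : DifferentiableAt ℂ (fun σ : ℂ => a ^ (1 - σ) / (σ - 1)) σ :=
      (differentiable_const_cpow_one_sub ha0 σ).fun_div (differentiableAt_id.sub_const 1)
        (sub_ne_zero.2 hσ.2)
    exact (h1.fun_add
      (differentiableAt_obreschkoffRegularPart hmn hσ.1 ha)).differentiableWithinAt
  eq_series := fun _ hs => (hurwitzSeries_eq_add_obreschkoffRegularPart hmn hs ha).symm

/-! ### Taylor coefficients at `σ = 1` -/

open Polynomial in
theorem iteratedDeriv_polynomial_eval (p : ℂ[X]) (k : ℕ) :
    iteratedDeriv k (fun s => p.eval s) = fun s => (derivative^[k] p).eval s := by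
  induction k generalizing p with
  | zero => simp
  | succ k ih =>
    rw [iteratedDeriv_succ', show deriv (fun s => p.eval s) = fun s => p.derivative.eval s from
      funext fun s => p.deriv, ih, Function.iterate_succ_apply]

/-- The Taylor coefficients of `(σ)_i` at `1` are Stirling numbers, as `(x)_{i+1} = x (x + 1)_i`. -/
theorem iteratedDeriv_poch_one (i k : ℕ) :
    iteratedDeriv k (fun σ => poch σ i) 1 =
      (k ! : ℂ) * ((-1) ^ (i + k) * (stirlingS (i + 1) (k + 1) : ℂ)) := by
  have h : (ascPochhammer ℂ (i + 1)).coeff (k + 1) =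
      (Polynomial.taylor 1 (ascPochhammer ℂ i)).coeff k := by
    rw [ascPochhammer_succ_left, Polynomial.coeff_X_mul, Polynomial.taylor_apply, Polynomial.C_1]
  have h2 : (ascPochhammer ℂ (i + 1)).coeff (k + 1) =
      (((ascPochhammer ℤ (i + 1)).coeff (k + 1) : ℤ) : ℂ) := by
    rw [← ascPochhammer_map (Int.castRingHom ℂ), Polynomial.coeff_map]
    simp
  simp only [poch, iteratedDeriv_polynomial_eval]
  rw [eval_iterate_derivative_eq_taylor_coeff, ← h, h2, stirlingS]
  congr 1
  push_cast
  rw [← mul_assoc, ← pow_add, Even.neg_one_pow ⟨i + k + 1, by ring⟩, one_mul]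

/-- Leibniz' rule at `σ = 1` for a product with `(σ)_i`. -/
theorem iteratedDeriv_poch_mul (ℓ i : ℕ) {f : ℂ → ℂ} (hf : AnalyticAt ℂ f 1) :
    iteratedDeriv ℓ (fun σ => poch σ i * f σ) 1 =
      (-1) ^ i * ∑ k ∈ Finset.range (ℓ + 1), (stirlingS (i + 1) (k + 1) : ℂ) *
        ((ℓ ! : ℂ) / ((ℓ - k)! : ℂ)) * (-1) ^ k * iteratedDeriv (ℓ - k) f 1 := by
  rw [iteratedDeriv_fun_mul ((differentiable_poch i).contDiff.contDiffAt) hf.contDiffAt,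
    Finset.mul_sum]
  refine Finset.sum_congr rfl fun k hk => ?_
  have hk : k ≤ ℓ := Nat.lt_succ_iff.1 (Finset.mem_range.1 hk)
  have h1 : (k ! : ℂ) ≠ 0 := by exact_mod_cast k.factorial_ne_zero
  rw [iteratedDeriv_poch_one, Nat.cast_choose ℂ hk, pow_add]
  field_simp

theorem iteratedDeriv_const_cpow_one_sub {a : ℂ} (ha : a ≠ 0) (r : ℕ) :
    iteratedDeriv r (fun σ : ℂ => a ^ (1 - σ)) 1 = (-1) ^ r * Complex.log a ^ r := by
  simp only [Complex.cpow_def_of_ne_zero ha]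
  rw [iteratedDeriv_comp_const_sub (f := fun w => Complex.exp (Complex.log a * w)),
    iteratedDeriv_cexp_const_mul]
  simp

/-- The Taylor coefficients of a difference quotient are those of the function, shifted by one. -/
theorem iteratedDeriv_dslope_self {f : ℂ → ℂ} (hf : Differentiable ℂ f) (c : ℂ) (ℓ : ℕ) :
    iteratedDeriv ℓ (dslope f c) c = iteratedDeriv (ℓ + 1) f c / ((ℓ : ℂ) + 1) := by
  have hd : Differentiable ℂ (dslope f c) := fun s =>
    ((Complex.differentiableOn_dslope (s := Set.univ) Filter.univ_mem).2
      hf.differentiableOn).differentiableAt Filter.univ_mem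
  have hmul : f = fun s => f c + (s - c) * dslope f c s := by
    funext s
    have := sub_smul_dslope f c s
    rw [smul_eq_mul] at this
    rw [this]
    ring
  have hl : ((ℓ : ℂ) + 1) ≠ 0 := by exact_mod_cast ℓ.succ_ne_zero
  have h1 : iteratedDeriv (ℓ + 1) f c = ((ℓ : ℂ) + 1) * iteratedDeriv ℓ (dslope f c) c := by
    conv_lhs => rw [hmul]
    rw [iteratedDeriv_fun_add contDiffAt_const (by
        exact ((contDiff_id.sub contDiff_const).mul hd.contDiff).contDiffAt),
      iteratedDeriv_fun_mul (by exact (contDiff_id.sub contDiff_const).contDiffAt)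
        hd.contDiff.contDiffAt, Finset.sum_range_succ', Finset.sum_range_succ']
    have hz : ∀ k : ℕ, iteratedDeriv (k + 1 + 1) (fun s : ℂ => s - c) c = 0 := fun k => by
      rw [iteratedDeriv_succ', iteratedDeriv_succ']
      simp
    simp [hz, iteratedDeriv_succ']
  rw [h1, mul_div_cancel_left₀ _ hl]

theorem analyticAt_one_of_differentiableAt_re_pos {f : ℂ → ℂ}
    (h : ∀ σ : ℂ, 0 < σ.re → DifferentiableAt ℂ f σ) : AnalyticAt ℂ f 1 :=
  DifferentiableOn.analyticAt (s := {σ : ℂ | 0 < σ.re})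
    (fun σ hσ => (h σ hσ).differentiableWithinAt) ((isOpen_re_lt_right 0).mem_nhds (by simp))

theorem iteratedDeriv_integral_beta_mul_hurwitzSeries (r : ℕ) {m n : ℕ} (hmn : 1 ≤ m + n) {a : ℂ}
    (ha : 0 < a.re) :
    iteratedDeriv r (fun σ => ∫ x in (0 : ℝ)..1, (x : ℂ) ^ m * (1 - (x : ℂ)) ^ n *
        hurwitzSeries (σ + ((m + n : ℕ) : ℂ)) (a + x)) 1 =
      ∫ x in (0 : ℝ)..1, remainderIntegrand r m n a x := by
  have hre := one_lt_re_add_natCast (σ := 1) (by simp) hmn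
  rw [iteratedDeriv_comp_add_const (f := fun s => ∫ x in (0 : ℝ)..1, (x : ℂ) ^ m *
    (1 - (x : ℂ)) ^ n * hurwitzSeries s (a + x))]
  beta_reduce
  rw [iteratedDeriv_integral_of_continuousOn_uncurry (isOpen_re_lt_right 1) r
    (F := fun x s => (x : ℂ) ^ m * (1 - (x : ℂ)) ^ n * hurwitzSeries s (a + x))
      (continuousOn_beta_mul_hurwitzSeries m n ha) (differentiableOn_beta_mul_hurwitzSeries m n ha)
      hre]
  refine intervalIntegral.integral_congr fun x hx => ?_
  rw [Set.uIcc_of_le zero_le_one] at hx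
  rw [iteratedDeriv_beta_mul_hurwitzSeries r m n hre ha hx, remainderIntegrand]
  congr 2
  push_cast
  ring

theorem intervalIntegrable_remainderIntegrand (r : ℕ) {m n : ℕ} (hmn : 1 ≤ m + n) {a : ℂ}
    (ha : 0 < a.re) : IntervalIntegrable (remainderIntegrand r m n a) volume 0 1 := by
  have hre := one_lt_re_add_natCast (σ := 1) (by simp) hmn
  refine ContinuousOn.intervalIntegrable_of_Icc zero_le_one ?_
  refine (continuousOn_slice (F := fun x => iteratedDeriv r fun s => (x : ℂ) ^ m *
    (1 - (x : ℂ)) ^ n * hurwitzSeries s (a + x)) (continuousOn_iteratedDeriv_of_continuousOn_uncurry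
      (isOpen_re_lt_right 1) r (F := fun (x : ℝ) s => (x : ℂ) ^ m *
    (1 - (x : ℂ)) ^ n * hurwitzSeries s (a + x))
      (continuousOn_beta_mul_hurwitzSeries m n ha) (differentiableOn_beta_mul_hurwitzSeries m n ha))
    hre).congr fun x hx => ?_
  simp only
  rw [iteratedDeriv_beta_mul_hurwitzSeries r m n hre ha hx, remainderIntegrand]
  congr 2
  push_cast
  ring

theorem iteratedDeriv_obreschkoffRegularPart (ℓ : ℕ) {m n : ℕ} (hmn : 1 ≤ m + n) {a : ℂ}
    (ha : 0 < a.re) :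
    iteratedDeriv ℓ (obreschkoffRegularPart m n a) 1 =
      (∑ j ∈ Finset.Icc 2 (max m n),
        (poch (-(m : ℂ)) j - (-1) ^ j * poch (-(n : ℂ)) j) / poch (-(n : ℂ) - m) j *
          ((-1) ^ j / (j ! : ℂ)) *
          ∑ k ∈ Finset.range (ℓ + 1),
            (stirlingS j (k + 1) : ℂ) * ((ℓ ! : ℂ) / ((ℓ - k)! : ℂ)) * (-1) ^ k *
              hurwitzZetaDeriv (ℓ - k) (j : ℂ) a) +
      (∑ k ∈ Finset.range (ℓ + 1),
        ((ℓ ! : ℂ) / ((ℓ - k)! : ℂ)) * Complex.log a ^ (ℓ - k) *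
          ∑ j ∈ Finset.Icc 1 m,
            poch (-(m : ℂ)) j / poch (-(n : ℂ) - m) j *
              ((-1) ^ (j + ℓ + 1) * a ^ (-(j : ℤ)) / (j ! : ℂ)) * (stirlingS j (k + 1) : ℂ)) +
      stieltjesRemainder ℓ m n a := by
  have ha0 : a ≠ 0 := fun h => by simp [h] at ha
  have hcpow : AnalyticAt ℂ (fun σ : ℂ => a ^ (1 - σ)) 1 :=
    analyticAt_one_of_differentiableAt_re_pos fun σ _ => differentiable_const_cpow_one_sub ha0 σ
  have hpoch : ∀ i, AnalyticAt ℂ (fun σ : ℂ => poch σ i) 1 := fun i =>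
    analyticAt_one_of_differentiableAt_re_pos fun σ _ => differentiable_poch i σ
  have hser : ∀ j ∈ Finset.Icc 2 (max m n),
      AnalyticAt ℂ (fun σ : ℂ => hurwitzSeries (σ + ((j - 1 : ℕ) : ℂ)) a) 1 := fun j hj =>
    analyticAt_one_of_differentiableAt_re_pos fun σ hσ =>
      differentiableAt_hurwitzSeries_add hσ ha (by have := (Finset.mem_Icc.1 hj).1; omega)
  have hint : AnalyticAt ℂ (fun σ => ∫ x in (0 : ℝ)..1, (x : ℂ) ^ m * (1 - (x : ℂ)) ^ n *
        hurwitzSeries (σ + ((m + n : ℕ) : ℂ)) (a + x)) 1 :=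
    analyticAt_one_of_differentiableAt_re_pos fun σ hσ =>
      differentiableAt_integral_beta_mul_hurwitzSeries hmn hσ ha
  have e1 : ∀ j ∈ Finset.Icc 1 m, ContDiffAt ℂ ℓ (fun σ => poch (-(m : ℂ)) j /
      poch (-(n : ℂ) - m) j * (a ^ (-(j : ℤ)) / (j ! : ℂ)) * (poch σ (j - 1) * a ^ (1 - σ))) 1 :=
    fun j _ => (analyticAt_const.mul ((hpoch _).mul hcpow)).contDiffAt
  have e2 : ∀ j ∈ Finset.Icc 2 (max m n), ContDiffAt ℂ ℓ (fun σ =>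
      (poch (-(m : ℂ)) j - (-1) ^ j * poch (-(n : ℂ)) j) / poch (-(n : ℂ) - m) j * (1 / (j ! : ℂ)) *
        (poch σ (j - 1) * hurwitzSeries (σ + ((j - 1 : ℕ) : ℂ)) a)) 1 :=
    fun j hj => (analyticAt_const.mul ((hpoch _).mul (hser j hj))).contDiffAt
  have e3 : ContDiffAt ℂ ℓ (fun σ => (-1) ^ n / ((m + n)! : ℂ) * (poch σ (m + n) *
      ∫ x in (0 : ℝ)..1, (x : ℂ) ^ m * (1 - (x : ℂ)) ^ n *
        hurwitzSeries (σ + ((m + n : ℕ) : ℂ)) (a + x))) 1 :=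
    (analyticAt_const.mul ((hpoch _).mul hint)).contDiffAt
  have hfun : obreschkoffRegularPart m n a = fun σ =>
      ∑ j ∈ Finset.Icc 1 m, poch (-(m : ℂ)) j / poch (-(n : ℂ) - m) j *
        (a ^ (-(j : ℤ)) / (j ! : ℂ)) * (poch σ (j - 1) * a ^ (1 - σ)) -
      ∑ j ∈ Finset.Icc 2 (max m n),
        (poch (-(m : ℂ)) j - (-1) ^ j * poch (-(n : ℂ)) j) / poch (-(n : ℂ) - m) j *
          (1 / (j ! : ℂ)) * (poch σ (j - 1) * hurwitzSeries (σ + ((j - 1 : ℕ) : ℂ)) a) -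
      (-1) ^ n / ((m + n)! : ℂ) * (poch σ (m + n) *
        ∫ x in (0 : ℝ)..1, (x : ℂ) ^ m * (1 - (x : ℂ)) ^ n *
          hurwitzSeries (σ + ((m + n : ℕ) : ℂ)) (a + x)) := rfl
  rw [hfun, iteratedDeriv_fun_sub ((ContDiffAt.sum e1).sub (ContDiffAt.sum e2)) e3,
    iteratedDeriv_fun_sub (ContDiffAt.sum e1) (ContDiffAt.sum e2), iteratedDeriv_fun_sum e1,
    iteratedDeriv_fun_sum e2]
  simp only [iteratedDeriv_const_mul_field]
  rw [sub_eq_add_neg, sub_eq_neg_add]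
  refine congrArg₂ (· + ·) (congrArg₂ (· + ·) ?_ ?_) ?_
  · rw [← Finset.sum_neg_distrib]
    refine Finset.sum_congr rfl fun j hj => ?_
    rw [iteratedDeriv_poch_mul _ _ (hser j hj)]
    obtain ⟨i, rfl⟩ : ∃ i, j = i + 1 := ⟨j - 1, by have := (Finset.mem_Icc.1 hj).1; omega⟩
    have hi : 1 ≤ i := by have := (Finset.mem_Icc.1 hj).1; omega
    have hD : ∀ r, iteratedDeriv r (fun σ => hurwitzSeries (σ + ((i + 1 - 1 : ℕ) : ℂ)) a) 1 =
        hurwitzZetaDeriv r ((i + 1 : ℕ) : ℂ) a := fun r => by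
      rw [iteratedDeriv_comp_add_const (f := fun s => hurwitzSeries s a), Nat.add_sub_cancel]
      beta_reduce
      rw [← hurwitzZetaDeriv_eq_iteratedDeriv_hurwitzSeries r
          (one_lt_re_add_natCast (by simp) hi) ha]
      congr 1
      push_cast
      ring
    simp only [hD]
    rw [Nat.add_sub_cancel, pow_succ (-1 : ℂ) i]
    ring
  · simp only [Finset.mul_sum]
    rw [Finset.sum_comm]
    refine Finset.sum_congr rfl fun j hj => ?_
    rw [iteratedDeriv_poch_mul _ _ hcpow]
    obtain ⟨i, rfl⟩ : ∃ i, j = i + 1 := ⟨j - 1, by have := (Finset.mem_Icc.1 hj).1; omega⟩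
    rw [Nat.add_sub_cancel, Finset.mul_sum, Finset.mul_sum]
    refine Finset.sum_congr rfl fun k hk => ?_
    have hk : k ≤ ℓ := Nat.lt_succ_iff.1 (Finset.mem_range.1 hk)
    have hsign : (-1 : ℂ) ^ k * (-1) ^ (ℓ - k) = (-1) ^ ℓ := by
      rw [← pow_add, Nat.add_sub_cancel' hk]
    rw [iteratedDeriv_const_cpow_one_sub ha0, show i + 1 + ℓ + 1 = i + ℓ + 2 by ring,
      pow_add (-1 : ℂ) (i + ℓ) 2, pow_add (-1 : ℂ) i ℓ, ← hsign]
    ring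
  · rw [iteratedDeriv_poch_mul _ _ hint, stieltjesRemainder]
    simp only [iteratedDeriv_integral_beta_mul_hurwitzSeries _ hmn ha]
    have h2 := neg_one_pow_mul_self n
    rw [pow_add, pow_succ]
    set S := ∑ k ∈ Finset.range (ℓ + 1), (stirlingS (m + n + 1) (k + 1) : ℂ) *
      ((ℓ ! : ℂ) / ((ℓ - k)! : ℂ)) * (-1) ^ k *
        ∫ x in (0 : ℝ)..1, remainderIntegrand (ℓ - k) m n a x
    linear_combination (-((-1) ^ m / ((m + n)! : ℂ) * S)) * h2

end

/-! ### The generalized Stieltjes constants -/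

theorem theorem2 (ℓ m n : ℕ) (hmn : 1 ≤ m + n) (a : ℂ) (ha : 0 < a.re) (ha' : 1 ≤ ‖a‖) :
    (∀ k ∈ Finset.range (ℓ + 1),
      IntervalIntegrable (remainderIntegrand (ℓ - k) m n a) MeasureTheory.volume 0 1) ∧
    (-1) ^ ℓ * stieltjesConst ℓ a =
      (∑ j ∈ Finset.Icc 2 (max m n),
        (poch (-(m : ℂ)) j - (-1) ^ j * poch (-(n : ℂ)) j) / poch (-(n : ℂ) - m) j *
          ((-1) ^ j / (j ! : ℂ)) *
          ∑ k ∈ Finset.range (ℓ + 1),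
            (stirlingS j (k + 1) : ℂ) * ((ℓ ! : ℂ) / ((ℓ - k)! : ℂ)) * (-1) ^ k *
              hurwitzZetaDeriv (ℓ - k) (j : ℂ) a) +
      (∑ k ∈ Finset.range (ℓ + 1),
        ((ℓ ! : ℂ) / ((ℓ - k)! : ℂ)) * Complex.log a ^ (ℓ - k) *
          ∑ j ∈ Finset.Icc 1 m,
            poch (-(m : ℂ)) j / poch (-(n : ℂ) - m) j *
              ((-1) ^ (j + ℓ + 1) * a ^ (-(j : ℤ)) / (j ! : ℂ)) * (stirlingS j (k + 1) : ℂ)) +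
      Complex.log a ^ (ℓ + 1) / ((ℓ : ℂ) + 1) * (-1) ^ (ℓ + 1) +
      stieltjesRemainder ℓ m n a := by
  refine ⟨fun k _ => intervalIntegrable_remainderIntegrand (ℓ - k) hmn ha, ?_⟩
  have ha0 : a ≠ 0 := fun h => by simp [h] at ha
  have hE := differentiable_const_cpow_one_sub ha0
  have hq : Differentiable ℂ (dslope (fun σ : ℂ => a ^ (1 - σ)) 1) := fun s =>
    ((Complex.differentiableOn_dslope (s := Set.univ) Filter.univ_mem).2
      hE.differentiableOn).differentiableAt Filter.univ_mem
  have hball : ∀ σ ∈ Metric.ball (1 : ℂ) 1, 0 < σ.re := fun σ hσ => by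
    have h1 := (Complex.abs_re_le_norm (σ - 1)).trans_lt (mem_ball_iff_norm.1 hσ)
    have h2 := (abs_lt.1 h1).1
    simp at h2
    linarith
  have hreg : ∀ σ : ℂ, 0 < σ.re → DifferentiableAt ℂ (obreschkoffRegularPart m n a) σ :=
    fun σ hσ => differentiableAt_obreschkoffRegularPart hmn hσ ha
  -- The pole `1 / (σ - 1)` is removed by replacing `a ^ (1 - σ) / (σ - 1)` with the difference quotient
  -- of `σ ↦ a ^ (1 - σ)` at `1`.
  rw [neg_one_pow_mul_stieltjesConst
    (G := fun σ => dslope (fun σ : ℂ => a ^ (1 - σ)) 1 σ + obreschkoffRegularPart m n a σ)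
    one_pos (fun σ hσ => ((hq σ).fun_add (hreg σ (hball σ hσ))).differentiableWithinAt) ?_,
    iteratedDeriv_fun_add hq.contDiff.contDiffAt
      (analyticAt_one_of_differentiableAt_re_pos hreg).contDiffAt,
    iteratedDeriv_dslope_self hE, iteratedDeriv_const_cpow_one_sub ha0,
    iteratedDeriv_obreschkoffRegularPart ℓ hmn ha]
  · ring
  · intro σ hσ hσ1
    have hne : σ - 1 ≠ 0 := sub_ne_zero.2 hσ1
    rw [(isHurwitzContinuation_obreschkoff hmn ha).hurwitzZetaC_eq hσ1 (hball σ hσ),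
      dslope_of_ne _ hσ1, slope_def_field, sub_self, Complex.cpow_zero]
    field_simp
    ring
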